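/- **Setting.** Let $B_r(0)$ be the open ball of radius $r$ around $0$ in $\mathbb R^2$, and $B_r^c(0)$ its complement. A (two-dimensional) *Lévy-type process* $\{F_t\}_{t\ge0}$ with symbol $q:\mathbb R^2\times\mathbb R^2\to\mathbb C$ and Lévy quadruple $(a(x),b(x),C(x),\nu(x,dy))$ is a conservative Feller process on $\mathbb R^2$ with Feller generator $(\mathcal A,\mathcal D_{\mathcal A})$ such that * (C1) $C_c^\infty(\mathbb R^2)\subseteq\mathcal D_{\mathcal A}$, and for $f\in C_c^\infty(\mathbb R^2)$ $$\mathcal Af(x)=-\int_{\mathbb R^2}q(x,\xi)e^{i\langle\xi,x\rangle}\hat f(\xi)\,d\xi,\qquad \hat f(\xi)=(2\pi)^{-2}\int_{\mathbb R^2}e^{-i\langle\xi,x\rangle}f(x)\,dx,$$ where $$q(x,\xi)=a(x)-i\langle\xi,b(x)\rangle+\tfrac12\langle\xi,C(x)\xi\rangle+\int_{\mathbb R^2}\bigl(1-e^{i\langle\xi,y\rangle}+i\langle\xi,y\rangle 1_{B_1(0)}(y)\bigr)\nu(x,dy),$$ $a\ge0$, $b$ and $C$ are Borel measurable, $C(x)$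 is symmetric non-negative definite, and $\nu$ is a Borel kernel with $\nu(x,\{0\})=0$ and $\int\min\{1,|y|^2\}\,\nu(x,dy)<\infty$ for all $x$ (the Lévy measure); * (C2) there is $c>0$ with $\sup_x|q(x,\xi)|\le c(1+|\xi|^2)$ for all $\xi$; * (C3) $q(x,0)=a(x)=0$ for all $x$. The symbol is *radial in the co-variable* if $q(x,R\xi)=q(x,\xi)$ for all $x,\xi\in\mathbb R^2$ and all rotations $R$ of the plane; it then takes values in $[0,\infty)$. A symmetric Borel measure $\mu$ on $\mathbb R$ is *quasi-unimodal with respect to* $u_0\ge0$ if $u\mapsto\mu((u,\infty))$ is a (finite) convex function on $(u_0,\infty)$. All integrals below are taken in $[0,\infty]$ with $1/0=\infty$. **Theorem 5.1.** Let $\{F_t\}_{t\ge0}$ and $\{\bar F_t\}_{t\ge0}$ be two-dimensional Lévy-type processes with symbols $q(x,\xi)$ and $\bar q(x,\xi)$, both radial in the co-variable, and Lévy measures $\nu(x,dy)$ and $\bar\nu(x,dy)$, respectively. Assume that 1. $\nu(x,du\times\mathbb R)$ is quasi-unimodal uniformly in $x$, that is, there is $u_0\ge0$ such that for every $x\in\mathbb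 R^2$ the measure $\nu(x,du\times\mathbb R)$ is quasi-unimodal with respect to $u_0$; 2. there is $u_0\ge0$ such that either $\nu(x,B_u^c(0))\ge\bar\nu(x,B_u^c(0))$ for all $x\in\mathbb R^2$ and all $u\ge u_0$, or $\nu(x,(u,\infty)\times\mathbb R)\ge\bar\nu(x,(u,\infty)\times\mathbb R)$ for all $x\in\mathbb R^2$ and all $u\ge u_0$. Then $$\int_{B_r(0)}\frac{d\xi}{\sup_{x\in\mathbb R^2}q(x,\xi)}=\infty\ \text{ for all } r>0\quad\Longrightarrow\quad\int_{B_r(0)}\frac{d\xi}{\sup_{x\in\mathbb R^2}\bar q(x,\xi)}=\infty\ \text{ for all } r>0 .$$ If, in addition, $$\liminf_{|\xi|\to0}\ \inf_{x\in\mathbb R^2}\int_{\mathbb R^2}\frac{1-\cos\langle\xi,y\rangle}{|\xi|^2}\,\nu(x,dy)=\infty,$$ then $$\int_{B_r(0)}\frac{d\xi}{\inf_{x\in\mathbb R^2}\bar q(x,\xi)}<\infty\ \text{ for some } r>0\quad\Longrightarrow\quad\int_{B_r(0)}\frac{d\xi}{\inf_{x\in\mathbb R^2}q(x,\xi)}<\infty\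 \text{ for some } r>0 .$$ -/

import Mathlib

open MeasureTheory ProbabilityTheory Filter Topology
open scoped NNReal ENNReal RealInnerProductSpace ZeroAtInfty

noncomputable section

namespace LevyType

/-- The state space `ℝᵈ` with its Euclidean norm and Borel `σ`-algebra. -/
abbrev Space (d : ℕ) : Type := EuclideanSpace ℝ (Fin d)

/-! ### Lévy quadruples and symbols -/

/-- An `x`-dependent Lévy quadruple `(a(x), b(x), C(x), ν(x,dy))`: Borel coefficients, with `a ≥ 0`,
`C(x)` symmetric non-negative definite, and `ν` a Borel kernel of Lévy measures. -/
structure LevyQuadruple (d : ℕ) where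
  a : Space d → ℝ
  b : Space d → Space d
  C : Space d → Matrix (Fin d) (Fin d) ℝ
  ν : Kernel (Space d) (Space d)
  measurable_a : Measurable a
  nonneg_a : ∀ x, 0 ≤ a x
  measurable_b : Measurable b
  measurable_C : ∀ i j, Measurable fun x => C x i j
  posSemidef_C : ∀ x, (C x).PosSemidef
  ν_zero : ∀ x, ν x {0} = 0
  ν_integrable : ∀ x, ∫⁻ y, ENNReal.ofReal (min 1 (‖y‖ ^ 2)) ∂(ν x) < ⊤

/-- The function `q(x,ξ)` given by the Lévy-Khintchine formula
`a(x) - i⟨ξ,b(x)⟩ + ½⟨ξ,C(x)ξ⟩ + ∫ (1 - e^{i⟨ξ,y⟩} + i⟨ξ,y⟩ 1_{B₁(0)}(y)) ν(x,dy)`.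
The integrand is `ν(x,·)`-integrable because `ν(x,·)` is a Lévy measure. -/
def LevyQuadruple.symbol {d : ℕ} (Q : LevyQuadruple d) (x ξ : Space d) : ℂ :=
  (Q.a x : ℂ) - Complex.I * ((⟪ξ, Q.b x⟫ : ℝ) : ℂ)
    + 1 / 2 * ((dotProduct ξ.ofLp ((Q.C x).mulVec ξ.ofLp) : ℝ) : ℂ)
    + ∫ y, (1 - Complex.exp (Complex.I * ((⟪ξ, y⟫ : ℝ) : ℂ))
        + (Metric.ball (0 : Space d) 1).indicator
            (fun y => Complex.I * ((⟪ξ, y⟫ : ℝ) : ℂ)) y) ∂(Q.ν x)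

/-! ### Feller processes and their generators -/

section FellerProcesses

variable {d : ℕ} {Ω : Type*} [MeasurableSpace Ω]

/-- `(F_t)` is a (time-homogeneous, conservative) Markov process on `ℝᵈ` with respect to the
filtration `ℱ` and the family of probability measures `P x = ℙˣ`, `x ∈ ℝᵈ`. -/
structure IsMarkovProcess (P : Kernel (Space d) Ω) (ℱ : Filtration ℝ≥0 ‹MeasurableSpace Ω›)
    (F : ℝ≥0 → Ω → Space d) : Prop where
  isMarkovKernel : IsMarkovKernel P
  adapted : ∀ t, Measurable[ℱ t] (F t)
  start : ∀ x, ∀ᵐ w ∂(P x), F 0 w = x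
  markov : ∀ (x : Space d) (s t : ℝ≥0) (B : Set (Space d)), MeasurableSet B →
    (P x)[(F (s + t) ⁻¹' B).indicator (fun _ => (1 : ℝ)) | ℱ s]
      =ᵐ[P x] fun w => (P (F s w)).real (F t ⁻¹' B)

/-- The operators `P_t f(x) = 𝔼ˣ[f(F_t)]`. -/
def semigroup (P : Kernel (Space d) Ω) (F : ℝ≥0 → Ω → Space d) (t : ℝ≥0) (f : Space d → ℝ)
    (x : Space d) : ℝ :=
  ∫ w, f (F t w) ∂(P x)

/-- A Feller process: a Markov process whose semigroup maps `C_∞(ℝᵈ)` (continuous functions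
vanishing at infinity) to itself and is strongly continuous there in the supremum norm. -/
structure IsFellerProcess (P : Kernel (Space d) Ω) (ℱ : Filtration ℝ≥0 ‹MeasurableSpace Ω›)
    (F : ℝ≥0 → Ω → Space d) : Prop extends IsMarkovProcess P ℱ F where
  mapsTo : ∀ (t : ℝ≥0) (f : C₀(Space d, ℝ)), ∃ g : C₀(Space d, ℝ), ∀ x, semigroup P F t f x = g x
  strongly_continuous : ∀ f : C₀(Space d, ℝ),
    TendstoUniformly (fun t x => semigroup P F t f x) f (𝓝[>] 0)

/-- `f` belongs to the domain of the Feller generator `𝒜` and `𝒜 f = g`, that is,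
`(P_t f - f) / t → g` in the supremum norm as `t ↓ 0`. -/
def HasGenerator (P : Kernel (Space d) Ω) (F : ℝ≥0 → Ω → Space d) (f g : C₀(Space d, ℝ)) : Prop :=
  TendstoUniformly (fun (t : ℝ≥0) x => (semigroup P F t f x - f x) / (t : ℝ)) g (𝓝[>] 0)

/-- The Fourier transform `f̂(ξ) = (2π)^{-d} ∫ e^{-i⟨ξ,x⟩} f(x) dx`. -/
def fourierHat (f : Space d → ℝ) (ξ : Space d) : ℂ :=
  ((2 * (Real.pi : ℂ)) ^ d)⁻¹ * ∫ x, Complex.exp (-(Complex.I * ((⟪ξ, x⟫ : ℝ) : ℂ))) * (f x : ℂ)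

/-- `(F_t)` is a Lévy-type process with Lévy quadruple `Q` and symbol `q = Q.symbol`: a Feller
process such that
* (C1) smooth compactly supported functions lie in the domain of the Feller generator `𝒜`, on which
  `𝒜 f(x) = -∫ q(x,ξ) e^{i⟨ξ,x⟩} f̂(ξ) dξ`;
* (C2) `sup_x |q(x,ξ)| ≤ c (1 + |ξ|²)`;
* (C3) `q(x,0) = a(x) = 0`. -/
structure IsLevyTypeProcess (P : Kernel (Space d) Ω) (ℱ : Filtration ℝ≥0 ‹MeasurableSpace Ω›)
    (F : ℝ≥0 → Ω → Space d) (Q : LevyQuadruple d) : Prop extends IsFellerProcess P ℱ F where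
  testFunction_mem_domain : ∀ f : C₀(Space d, ℝ), ContDiff ℝ ((⊤ : ℕ∞) : WithTop ℕ∞) f →
    HasCompactSupport f → ∃ g : C₀(Space d, ℝ), HasGenerator P F f g
  generator_eq : ∀ f g : C₀(Space d, ℝ), ContDiff ℝ ((⊤ : ℕ∞) : WithTop ℕ∞) f →
    HasCompactSupport f → HasGenerator P F f g → ∀ x, ((g x : ℝ) : ℂ) =
      -∫ ξ, Q.symbol x ξ * Complex.exp (Complex.I * ((⟪ξ, x⟫ : ℝ) : ℂ)) * fourierHat f ξ
  symbol_growth : ∃ c : ℝ, 0 < c ∧ ∀ x ξ, ‖Q.symbol x ξ‖ ≤ c * (1 + ‖ξ‖ ^ 2)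
  symbol_zero : ∀ x, Q.symbol x 0 = 0

end FellerProcesses

/-! ### The conditions in the plane -/

/-- The rotation `R_φ` of the plane. -/
def rotation (φ : ℝ) (ξ : Space 2) : Space 2 :=
  !₂[Real.cos φ * ξ 0 - Real.sin φ * ξ 1, Real.sin φ * ξ 0 + Real.cos φ * ξ 1]

/-- `q(x,ξ)` is radial in the co-variable `ξ`. -/
def IsRadialSymbol (q : Space 2 → Space 2 → ℂ) : Prop :=
  ∀ x, ∀ φ ∈ Set.Ico (0 : ℝ) (2 * Real.pi), ∀ ξ, q x (rotation φ ξ) = q x ξ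

/-- The measure `μ(du × ℝ)` on `ℝ`, for a measure `μ` on the plane. -/
def firstMarginal (μ : Measure (Space 2)) : Measure ℝ :=
  μ.map fun y => y 0

/-- A symmetric Borel measure `μ` on `ℝ` is quasi-unimodal with respect to `u₀ ≥ 0` if
`u ↦ μ(u,∞)` is a (finite) convex function on `(u₀,∞)`. -/
structure IsQuasiUnimodal (μ : Measure ℝ) (u₀ : ℝ) : Prop where
  nonneg : 0 ≤ u₀
  symmetric : μ.map (fun u => -u) = μ
  finite_tail : ∀ u, u₀ < u → μ (Set.Ioi u) < ⊤
  convex_tail : ConvexOn ℝ (Set.Ioi u₀) fun u => (μ (Set.Ioi u)).toReal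

/-- `liminf_{|ξ| → 0} inf_x ∫ (1 - cos⟨ξ,y⟩) / |ξ|² ν(x,dy) = ∞`. -/
def InfiniteLowerSecondMoment (ν : Kernel (Space 2) (Space 2)) : Prop :=
  liminf (fun ξ : Space 2 =>
    ⨅ x, ∫⁻ y, ENNReal.ofReal ((1 - Real.cos ⟪ξ, y⟫) / ‖ξ‖ ^ 2) ∂(ν x)) (𝓝[≠] 0) = ⊤

/-- `∫_{B_r(0)} dξ / sup_x q(x,ξ)` in `[0,∞]`, with `1/0 = ∞`, for a symbol with values in `[0,∞)`
(a radial symbol is of this kind). -/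
def integralInvSup (q : Space 2 → Space 2 → ℂ) (r : ℝ) : ℝ≥0∞ :=
  ∫⁻ ξ in Metric.ball (0 : Space 2) r, (⨆ x, ENNReal.ofReal (q x ξ).re)⁻¹

/-- `∫_{B_r(0)} dξ / inf_x q(x,ξ)` in `[0,∞]`, with `1/0 = ∞`, for a symbol with values in `[0,∞)`
(a radial symbol is of this kind). -/
def integralInvInf (q : Space 2 → Space 2 → ℂ) (r : ℝ) : ℝ≥0∞ :=
  ∫⁻ ξ in Metric.ball (0 : Space 2) r, (⨅ x, ENNReal.ofReal (q x ξ).re)⁻¹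

end LevyType

end

namespace LevyType

/-! ### Elementary estimates -/

/-! A radial symbol is comparable, up to a term of order `|ξ|²`, to the truncated second moment `∫
min(1, |ξ|²|y|²) ν(x,dy)`. The lower bound comes from averaging `1 - cos⟨Rξ,y⟩` over all rotations
`R`: the average is at least a constant times `min(1, |ξ|²|y|²)`, while radiality leaves the symbol
unchanged (`truncMoment_le_symbol`). For the upper bound, rotate `ξ` onto the first axis and use `1
- cos z ≤ 2 min(1, z²)` (`symbol_re_le`).

A truncated moment is monotone in the tails, by the layer-cake formula; jumps below the threshold
and the diffusion part cost only `O(|ξ|²)`, uniformly in `x` by the growth condition. Hence `q' ≤ K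
(|ξ|² + truncMoment)`, with the truncated moment of `Q` (`exists_symbol_re_le`).

It remains to absorb `|ξ|²` into the symbol of `Q`. For the supremum, a single nonzero Lévy measure
suffices near the origin; if all vanish, `|ξ|⁻²` already has a divergent integral in the plane. For
the infimum, the moment condition gives `|ξ|² ≤ q(x,ξ)` near the origin for every `x`. -/

lemma mul_min_one_sq_le_sub_sin {s : ℝ} (hs : 0 < s) :
    s * (min 1 (s ^ 2) / 20) ≤ s - Real.sin s := by
  rcases le_or_gt s 2 with h | h
  · have hsin : Real.sin s = 2 * Real.sin (s / 2) * Real.cos (s / 2) := by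
      rw [← Real.sin_two_mul]; ring_nf
    have h1 : Real.sin (s / 2) ≤ s / 2 := Real.sin_le (by linarith)
    have hpi := Real.pi_gt_three
    have hcos : Real.cos (s / 2) ≤ 1 - 2 / Real.pi ^ 2 * (s / 2) ^ 2 :=
      Real.cos_le_one_sub_mul_cos_sq (by rw [abs_of_pos (by linarith)]; linarith)
    have hcos0 : 0 ≤ Real.cos (s / 2) :=
      Real.cos_nonneg_of_mem_Icc ⟨by linarith, by linarith⟩
    have h3 : 2 * Real.sin (s / 2) * Real.cos (s / 2) ≤ s * Real.cos (s / 2) := by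
      nlinarith
    have hm : min 1 (s ^ 2) ≤ 1 := min_le_left _ _
    have hm' : min 1 (s ^ 2) ≤ s ^ 2 := min_le_right _ _
    -- This is `π² ≤ 10`; together with the square of `s / 2` it yields 20 = 5 · 4.
    have hp : 2 / Real.pi ^ 2 ≥ 1 / 5 := by
      rw [ge_iff_le, div_le_div_iff₀ (by norm_num) (by positivity)]
      nlinarith [Real.pi_lt_d2]
    have h4 : Real.cos (s / 2) ≤ 1 - s ^ 2 / 20 := by nlinarith [sq_nonneg (s / 2)]
    rw [hsin]
    nlinarith
  · have hm : min 1 (s ^ 2) ≤ 1 := min_le_left _ _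
    nlinarith [Real.sin_le_one s]

/-- The weight `sin φ` makes the integrand an exact derivative in `cos φ`, so an elementary integral
can stand in for the Bessel function. -/
lemma integral_sin_mul_one_sub_cos_mul_cos {s : ℝ} (hs : s ≠ 0) :
    ∫ φ in (0 : ℝ)..Real.pi, Real.sin φ * (1 - Real.cos (s * Real.cos φ))
      = 2 * ((s - Real.sin s) / s) := by
  have hd : ∀ φ ∈ Set.uIcc (0 : ℝ) Real.pi,
      HasDerivAt (fun φ => -Real.cos φ + Real.sin (s * Real.cos φ) / s)
        (Real.sin φ * (1 - Real.cos (s * Real.cos φ))) φ := by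
    intro φ _
    have h1 := (Real.hasDerivAt_cos φ).neg
    have h2 := (((Real.hasDerivAt_cos φ).const_mul s).sin).div_const s
    refine (h1.add h2).congr_deriv ?_
    field_simp
    ring
  rw [intervalIntegral.integral_eq_sub_of_hasDerivAt hd
    (Continuous.intervalIntegrable (by fun_prop) _ _)]
  simp only [Real.cos_pi, Real.cos_zero, mul_neg, mul_one, Real.sin_neg]
  field_simp
  ring

/-- The circular averages of `1 - cos` dominate `min(1, s²)`: a lower bound for the Bessel function
expression `1 - J₀(s)`. -/
lemma min_one_sq_le_integral_one_sub_cos (A B : ℝ) :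
    min 1 (A ^ 2 + B ^ 2) / 10
      ≤ ∫ φ in (0 : ℝ)..(2 * Real.pi), (1 - Real.cos (A * Real.cos φ + B * Real.sin φ)) := by
  -- Polar coordinates turn `A cos φ + B sin φ` into `s cos (φ - α)`; periodicity then removes the
  -- phase `α`.
  set z : ℂ := ⟨A, B⟩ with hz
  set s := ‖z‖ with hs
  set α := z.arg with hα
  have hA : s * Real.cos α = A := by rw [hs, hα, Complex.norm_mul_cos_arg]
  have hB : s * Real.sin α = B := by rw [hs, hα, Complex.norm_mul_sin_arg]
  have hAB : A ^ 2 + B ^ 2 = s ^ 2 := by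
    rw [← hA, ← hB]
    linear_combination s ^ 2 * Real.sin_sq_add_cos_sq α
  let g : ℝ → ℝ := fun φ => 1 - Real.cos (s * Real.cos φ)
  have hg : Function.Periodic g (2 * Real.pi) := fun φ => by simp [g]
  have hgc : Continuous g := by fun_prop
  have hg0 : ∀ φ, 0 ≤ g φ := fun φ => by
    have := Real.cos_le_one (s * Real.cos φ); simp only [g]; linarith
  have h1 : ∫ φ in (0 : ℝ)..(2 * Real.pi), (1 - Real.cos (A * Real.cos φ + B * Real.sin φ))
      = ∫ φ in (0 : ℝ)..(2 * Real.pi), g φ := by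
    have : ∀ φ, 1 - Real.cos (A * Real.cos φ + B * Real.sin φ) = g (φ - α) := fun φ => by
      simp only [g, Real.cos_sub, ← hA, ← hB]; ring_nf
    simp_rw [this]
    rw [intervalIntegral.integral_comp_sub_right]
    have := hg.intervalIntegral_add_eq (0 - α) 0
    rw [show 0 - α + 2 * Real.pi = 2 * Real.pi - α by ring, zero_add] at this
    exact this
  have h2 : ∫ φ in (0 : ℝ)..Real.pi, g φ ≤ ∫ φ in (0 : ℝ)..(2 * Real.pi), g φ := by
    refine intervalIntegral.integral_mono_interval le_rfl Real.pi_pos.le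
      (by linarith [Real.pi_pos]) (ae_of_all _ hg0) (hgc.intervalIntegrable _ _)
  -- Inserting `sin φ ≤ 1` gives away a constant factor but makes the integral explicit.
  have h3 : ∫ φ in (0 : ℝ)..Real.pi, Real.sin φ * g φ ≤ ∫ φ in (0 : ℝ)..Real.pi, g φ := by
    refine intervalIntegral.integral_mono_on Real.pi_pos.le
      (Continuous.intervalIntegrable (by fun_prop) _ _) (hgc.intervalIntegrable _ _) ?_
    intro φ _
    nlinarith [hg0 φ, Real.sin_le_one φ]
  rw [hAB, h1]
  rcases eq_or_ne s 0 with h | h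
  · refine le_trans ?_ (intervalIntegral.integral_nonneg (by positivity) fun φ _ => hg0 φ)
    simp [h]
  · have hs0 : 0 < s := lt_of_le_of_ne (norm_nonneg z) (Ne.symm h)
    refine le_trans ?_ (h3.trans h2)
    rw [integral_sin_mul_one_sub_cos_mul_cos h]
    have := mul_min_one_sq_le_sub_sin hs0
    rw [mul_comm, ← le_div_iff₀ hs0] at this
    linarith

lemma one_sub_cos_le_two_mul_min (z : ℝ) : 1 - Real.cos z ≤ 2 * min 1 (z ^ 2) := by
  rcases le_total 1 (z ^ 2) with h | h
  · rw [min_eq_left h]; linarith [Real.neg_one_le_cos z]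
  · rw [min_eq_right h]; nlinarith [Real.one_sub_sq_div_two_le_cos (x := z), sq_nonneg z]

/-- `|ξ|⁻²` is not integrable at the origin of the plane. -/
lemma setLIntegral_inv_norm_sq_eq_top {r : ℝ} (hr : 0 < r) :
    ∫⁻ ξ in Metric.ball (0 : Space 2) r, (ENNReal.ofReal (‖ξ‖ ^ 2))⁻¹ = ⊤ := by
  by_contra hfin
  have h1 : ∀ᵐ ξ ∂(volume.restrict (Metric.ball (0 : Space 2) r)),
      (ENNReal.ofReal (‖ξ‖ ^ 2))⁻¹ = ENNReal.ofReal ((‖ξ‖ ^ 2)⁻¹) := by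
    have : ∀ᵐ ξ ∂(volume : Measure (Space 2)), ξ ≠ 0 := by
      simp [ae_iff]
    filter_upwards [ae_restrict_of_ae this] with ξ hξ
    rw [ENNReal.ofReal_inv_of_pos (by positivity)]
  have hint : IntegrableOn (fun ξ : Space 2 => (‖ξ‖ ^ 2)⁻¹) (Metric.ball 0 r) := by
    refine ⟨by fun_prop, ?_⟩
    rw [hasFiniteIntegral_iff_ofReal (ae_of_all _ fun ξ => by positivity),
      ← lintegral_congr_ae h1]
    exact lt_top_iff_ne_top.2 hfin
  have h2 := (integrableOn_fun_norm_addHaar (E := Space 2) volume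
    (f := fun t : ℝ => (t ^ 2)⁻¹) (r := r)).1 hint
  -- In dimension two the radial Jacobian is `y`, and `y · y⁻² = y⁻¹` is not integrable at 0.
  have h3 : IntegrableOn (fun y : ℝ => y ^ (-1 : ℝ)) (Set.Ioo 0 r) := by
    refine h2.congr_fun ?_ measurableSet_Ioo
    intro y hy
    have : y ≠ 0 := hy.1.ne'
    simp only [finrank_euclideanSpace_fin, Real.rpow_neg_one, smul_eq_mul]
    field_simp
    norm_num
  rw [intervalIntegral.integrableOn_Ioo_rpow_iff hr] at h3
  exact lt_irrefl _ h3

/-- Comparison of truncated second moments from a comparison of the tails. -/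
lemma lintegral_min_one_sq_le_of_tail_le {E : Type*} [MeasurableSpace E] {μ μ' : Measure E}
    {g : E → ℝ} (hg : Measurable g) (hg0 : ∀ y, 0 ≤ g y) {v : ℝ} {k : ℝ≥0∞}
    (htail : ∀ u, v ≤ u → μ' {y | u < g y} ≤ k * μ {y | u < g y}) {ρ : ℝ} (hρ : 0 ≤ ρ) :
    ∫⁻ y, ENNReal.ofReal (min 1 (ρ ^ 2 * g y ^ 2)) ∂μ'
      ≤ (∫⁻ y, ENNReal.ofReal (ρ ^ 2 * min (g y) v ^ 2) ∂μ')
        + k * ∫⁻ y, ENNReal.ofReal (min 1 (ρ ^ 2 * g y ^ 2)) ∂μ := by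
  -- The excess over the value at `g = v`. Its superlevel sets at positive heights are empty or
  -- superlevel sets of `g` at heights at least `v`, where the tail hypothesis applies.
  let f : E → ℝ := fun y => max 0 (min 1 (ρ ^ 2 * g y ^ 2) - ρ ^ 2 * v ^ 2)
  have hf : Measurable f := by fun_prop
  have hf0 : ∀ y, 0 ≤ f y := fun y => le_max_left _ _
  have hset : ∀ t, 0 < t → μ' {y | t < f y} ≤ k * μ {y | t < f y} := by
    intro t ht
    rcases eq_or_lt_of_le hρ with h0 | hρ0
    · have : {y | t < f y} = ∅ := by
        ext y; simp [f, ← h0, ht.le]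
      simp [this]
    rcases lt_or_ge (t + ρ ^ 2 * v ^ 2) 1 with h1 | h1
    · have : {y | t < f y} = {y | √(t + ρ ^ 2 * v ^ 2) / ρ < g y} := by
        ext y
        simp only [Set.mem_ofPred_eq, f, lt_max_iff, ht.not_gt, false_or, lt_sub_iff_add_lt,
          lt_min_iff, h1, true_and]
        rw [div_lt_iff₀ hρ0, ← Real.sqrt_sq (mul_nonneg (hg0 y) hρ),
          Real.sqrt_lt_sqrt_iff (by positivity), mul_pow, mul_comm (g y ^ 2)]
      rw [this]
      refine htail _ ?_
      rw [le_div_iff₀ hρ0]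
      apply Real.le_sqrt_of_sq_le
      nlinarith
    · have : {y | t < f y} = ∅ := by
        ext y
        simp only [Set.mem_ofPred_eq, f, lt_max_iff, ht.not_gt, false_or, lt_sub_iff_add_lt,
          lt_min_iff, Set.mem_empty_iff_false, iff_false, not_and_or]
        exact Or.inl h1.not_gt
      simp [this]
  have hle : ∫⁻ y, ENNReal.ofReal (f y) ∂μ' ≤ k * ∫⁻ y, ENNReal.ofReal (f y) ∂μ := by
    rw [lintegral_eq_lintegral_meas_lt μ' (ae_of_all _ hf0) hf.aemeasurable,
      lintegral_eq_lintegral_meas_lt μ (ae_of_all _ hf0) hf.aemeasurable,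
      ← lintegral_const_mul]
    · exact setLIntegral_mono' measurableSet_Ioi fun t ht => hset t ht
    · refine Antitone.measurable fun s t hst => measure_mono fun y hy => ?_
      exact lt_of_le_of_lt hst hy
  have hpt : ∀ y, min 1 (ρ ^ 2 * g y ^ 2) ≤ ρ ^ 2 * min (g y) v ^ 2 + f y := by
    intro y
    rcases le_total (g y) v with h | h
    · rw [min_eq_left h]
      linarith [min_le_right 1 (ρ ^ 2 * g y ^ 2), hf0 y]
    · rw [min_eq_right h]
      linarith [le_max_right 0 (min 1 (ρ ^ 2 * g y ^ 2) - ρ ^ 2 * v ^ 2)]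
  have hfle : ∀ y, f y ≤ min 1 (ρ ^ 2 * g y ^ 2) := fun y =>
    max_le (by positivity) (by nlinarith [mul_nonneg (sq_nonneg ρ) (sq_nonneg v)])
  calc ∫⁻ y, ENNReal.ofReal (min 1 (ρ ^ 2 * g y ^ 2)) ∂μ'
      ≤ ∫⁻ y, (ENNReal.ofReal (ρ ^ 2 * min (g y) v ^ 2) + ENNReal.ofReal (f y)) ∂μ' := by
        refine lintegral_mono fun y => ?_
        rw [← ENNReal.ofReal_add (by positivity) (hf0 y)]
        exact ENNReal.ofReal_le_ofReal (hpt y)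
    _ = (∫⁻ y, ENNReal.ofReal (ρ ^ 2 * min (g y) v ^ 2) ∂μ')
          + ∫⁻ y, ENNReal.ofReal (f y) ∂μ' :=
        lintegral_add_right _ hf.ennreal_ofReal
    _ ≤ _ := by
        gcongr
        refine hle.trans ?_
        gcongr with y
        exact hfle y

namespace LevyQuadruple

/-! ### Real and imaginary part of the symbol -/

section Symbol

variable {d : ℕ} (Q : LevyQuadruple d)

lemma integrable_min_one_norm_sq (x : Space d) :
    Integrable (fun y => min 1 (‖y‖ ^ 2)) (Q.ν x) := by
  refine ⟨by fun_prop, ?_⟩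
  rw [hasFiniteIntegral_iff_ofReal (ae_of_all _ fun y => by positivity)]
  exact Q.ν_integrable x

lemma ae_ne_zero (x : Space d) : ∀ᵐ y ∂(Q.ν x), y ≠ 0 := by
  simpa [ae_iff] using Q.ν_zero x

/-- The density `min(1, |y|²)` makes the measure finite and is positive off the null set `{0}`. This
licenses the Tonelli swap in `truncMoment_le_symbol`. -/
instance sFinite_ν (x : Space d) : SFinite (Q.ν x) := by
  have hfin : IsFiniteMeasure
      ((Q.ν x).withDensity fun y => ENNReal.ofReal (min 1 (‖y‖ ^ 2))) := by
    refine isFiniteMeasure_withDensity (Q.ν_integrable x).ne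
  refine sFinite_of_absolutelyContinuous (withDensity_absolutelyContinuous'
    (f := fun y => ENNReal.ofReal (min 1 (‖y‖ ^ 2))) (by fun_prop) ?_)
  filter_upwards [Q.ae_ne_zero x] with y hy
  simpa using hy

/-- Taylor remainder for `|z| ≤ 1`; otherwise the trivial bound `2 + |z| ≤ 3z²`. Large `z` matters
because `⟨ξ,y⟩` can be large even for `|y| < 1`. -/
lemma norm_one_sub_exp_add_le (z : ℝ) :
    ‖1 - Complex.exp (Complex.I * (z : ℂ)) + Complex.I * (z : ℂ)‖ ≤ 3 * z ^ 2 := by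
  have hn : ‖Complex.I * (z : ℂ)‖ = |z| := by simp
  rcases le_or_gt |z| 1 with h | h
  · have := Complex.norm_exp_sub_one_sub_id_le (x := Complex.I * (z : ℂ)) (by rwa [hn])
    rw [hn, sq_abs, ← norm_neg] at this
    refine le_trans (le_of_eq ?_) (this.trans (by nlinarith [sq_nonneg z]))
    congr 1; ring
  · have he : ‖Complex.exp (Complex.I * (z : ℂ))‖ = 1 := by
      rw [mul_comm, Complex.norm_exp_ofReal_mul_I]
    calc _ ≤ ‖(1 : ℂ)‖ + ‖Complex.exp (Complex.I * (z : ℂ))‖ + ‖Complex.I * (z : ℂ)‖ :=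
          (norm_add_le _ _).trans (by gcongr; exact norm_sub_le _ _)
      _ ≤ 3 * z ^ 2 := by rw [he, hn, ← sq_abs, norm_one]; nlinarith

lemma norm_one_sub_exp_le (z : ℝ) :
    ‖1 - Complex.exp (Complex.I * (z : ℂ))‖ ≤ 2 := by
  have he : ‖Complex.exp (Complex.I * (z : ℂ))‖ = 1 := by
    rw [mul_comm, Complex.norm_exp_ofReal_mul_I]
  refine (norm_sub_le _ _).trans ?_
  rw [he]; norm_num

/-- The integrand in the Lévy-Khintchine formula. -/
noncomputable def symbolIntegrand (ξ y : Space d) : ℂ :=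
  1 - Complex.exp (Complex.I * ((⟪ξ, y⟫ : ℝ) : ℂ))
    + (Metric.ball (0 : Space d) 1).indicator (fun y => Complex.I * ((⟪ξ, y⟫ : ℝ) : ℂ)) y

lemma measurable_symbolIntegrand (ξ : Space d) : Measurable (symbolIntegrand ξ) := by
  unfold symbolIntegrand
  refine Measurable.add (by fun_prop) (Measurable.indicator (by fun_prop) measurableSet_ball)

lemma norm_symbolIntegrand_le (ξ y : Space d) :
    ‖symbolIntegrand ξ y‖ ≤ (3 * ‖ξ‖ ^ 2 + 2) * min 1 (‖y‖ ^ 2) := by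
  unfold symbolIntegrand
  by_cases hy : y ∈ Metric.ball (0 : Space d) 1
  · rw [Set.indicator_of_mem hy]
    refine (norm_one_sub_exp_add_le _).trans ?_
    have h1 : ‖y‖ < 1 := by simpa using hy
    have h2 : ‖y‖ ^ 2 ≤ 1 := by nlinarith [norm_nonneg y]
    rw [min_eq_right h2]
    have h3 : (⟪ξ, y⟫ : ℝ) ^ 2 ≤ ‖ξ‖ ^ 2 * ‖y‖ ^ 2 := by
      rw [← mul_pow, ← sq_abs]
      gcongr
      exact abs_real_inner_le_norm ξ y
    nlinarith [sq_nonneg ‖y‖]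
  · rw [Set.indicator_of_notMem hy, add_zero]
    refine (norm_one_sub_exp_le _).trans ?_
    have h1 : 1 ≤ ‖y‖ := by simpa using hy
    rw [min_eq_left (by nlinarith)]
    nlinarith [sq_nonneg ‖ξ‖]

lemma integrable_symbolIntegrand (x ξ : Space d) : Integrable (symbolIntegrand ξ) (Q.ν x) :=
  ((Q.integrable_min_one_norm_sq x).const_mul (3 * ‖ξ‖ ^ 2 + 2)).mono'
    (measurable_symbolIntegrand ξ).aestronglyMeasurable
    (ae_of_all _ (norm_symbolIntegrand_le ξ))

lemma symbol_eq (x ξ : Space d) : Q.symbol x ξ =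
    (Q.a x : ℂ) - Complex.I * ((⟪ξ, Q.b x⟫ : ℝ) : ℂ)
      + 1 / 2 * ((dotProduct ξ.ofLp ((Q.C x).mulVec ξ.ofLp) : ℝ) : ℂ)
      + ∫ y, symbolIntegrand ξ y ∂(Q.ν x) := rfl

lemma symbolIntegrand_re (ξ y : Space d) :
    (symbolIntegrand ξ y).re = 1 - Real.cos ⟪ξ, y⟫ := by
  unfold symbolIntegrand
  rw [mul_comm Complex.I]
  by_cases hy : y ∈ Metric.ball (0 : Space d) 1
  · rw [Set.indicator_of_mem hy]
    simp [Complex.exp_ofReal_mul_I_re]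
  · rw [Set.indicator_of_notMem hy]
    simp [Complex.exp_ofReal_mul_I_re]

lemma symbolIntegrand_im (ξ y : Space d) :
    (symbolIntegrand ξ y).im
      = -Real.sin ⟪ξ, y⟫ + (Metric.ball (0 : Space d) 1).indicator (fun y => ⟪ξ, y⟫) y := by
  unfold symbolIntegrand
  rw [mul_comm Complex.I]
  by_cases hy : y ∈ Metric.ball (0 : Space d) 1
  · rw [Set.indicator_of_mem hy, Set.indicator_of_mem hy]
    simp [Complex.exp_ofReal_mul_I_im]
  · rw [Set.indicator_of_notMem hy, Set.indicator_of_notMem hy]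
    simp [Complex.exp_ofReal_mul_I_im]

lemma integrable_one_sub_cos (x ξ : Space d) :
    Integrable (fun y => 1 - Real.cos ⟪ξ, y⟫) (Q.ν x) := by
  simpa only [RCLike.re_to_complex, symbolIntegrand_re] using
    (Q.integrable_symbolIntegrand x ξ).re

lemma symbol_re (x ξ : Space d) : (Q.symbol x ξ).re =
    Q.a x + 1 / 2 * dotProduct ξ.ofLp ((Q.C x).mulVec ξ.ofLp)
      + ∫ y, (1 - Real.cos ⟪ξ, y⟫) ∂(Q.ν x) := by
  have h : (∫ y, symbolIntegrand ξ y ∂(Q.ν x)).re = ∫ y, (1 - Real.cos ⟪ξ, y⟫) ∂(Q.ν x) := by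
    simp_rw [← symbolIntegrand_re]
    exact (Complex.reCLM.integral_comp_comm (Q.integrable_symbolIntegrand x ξ)).symm
  have h2 : (1 / 2 : ℂ) = ((1 / 2 : ℝ) : ℂ) := by norm_num
  rw [symbol_eq, Complex.add_re, h, h2, ← Complex.ofReal_mul]
  simp

lemma symbol_im (x ξ : Space d) : (Q.symbol x ξ).im =
    -⟪ξ, Q.b x⟫ + ∫ y, (symbolIntegrand ξ y).im ∂(Q.ν x) := by
  have h : (∫ y, symbolIntegrand ξ y ∂(Q.ν x)).im = ∫ y, (symbolIntegrand ξ y).im ∂(Q.ν x) :=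
    (Complex.imCLM.integral_comp_comm (Q.integrable_symbolIntegrand x ξ)).symm
  have h2 : (1 / 2 : ℂ) = ((1 / 2 : ℝ) : ℂ) := by norm_num
  rw [symbol_eq, Complex.add_im, h, h2, ← Complex.ofReal_mul]
  simp

lemma quadraticForm_nonneg (x ξ : Space d) :
    0 ≤ dotProduct ξ.ofLp ((Q.C x).mulVec ξ.ofLp) := by
  simpa using (Q.posSemidef_C x).dotProduct_mulVec_nonneg ξ.ofLp

lemma ofReal_symbol_re (x ξ : Space d) : ENNReal.ofReal (Q.symbol x ξ).re =
    ENNReal.ofReal (Q.a x + 1 / 2 * dotProduct ξ.ofLp ((Q.C x).mulVec ξ.ofLp))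
      + ∫⁻ y, ENNReal.ofReal (1 - Real.cos ⟪ξ, y⟫) ∂(Q.ν x) := by
  have hc : ∀ y, 0 ≤ 1 - Real.cos ⟪ξ, y⟫ := fun y => by linarith [Real.cos_le_one ⟪ξ, y⟫]
  have h1 := Q.nonneg_a x
  have h2 := Q.quadraticForm_nonneg x ξ
  rw [symbol_re, ENNReal.ofReal_add (by positivity) (integral_nonneg hc),
    ofReal_integral_eq_lintegral_ofReal (Q.integrable_one_sub_cos x ξ) (ae_of_all _ hc)]

lemma lintegral_one_sub_cos_le_symbol (x ξ : Space d) :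
    ∫⁻ y, ENNReal.ofReal (1 - Real.cos ⟪ξ, y⟫) ∂(Q.ν x) ≤ ENNReal.ofReal (Q.symbol x ξ).re := by
  rw [ofReal_symbol_re]; exact le_add_self

lemma symbol_neg_im (x ξ : Space d) : (Q.symbol x (-ξ)).im = -(Q.symbol x ξ).im := by
  have : ∀ y, (symbolIntegrand (-ξ) y).im = -(symbolIntegrand ξ y).im := fun y => by
    rw [symbolIntegrand_im, symbolIntegrand_im]
    by_cases hy : y ∈ Metric.ball (0 : Space d) 1
    · rw [Set.indicator_of_mem hy, Set.indicator_of_mem hy]; simp; ring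
    · rw [Set.indicator_of_notMem hy, Set.indicator_of_notMem hy]; simp
  rw [symbol_im, symbol_im]
  simp_rw [this]
  rw [integral_neg, inner_neg_left]
  ring

/-- If the symbol is real, then the Lévy measure is symmetric after multiplication by
`1 - cos⟨η,y⟩`. -/
lemma symmetric_withDensity_of_im_eq_zero {x : Space d} (him : ∀ ξ, (Q.symbol x ξ).im = 0)
    (η : Space d) :
    ((Q.ν x).withDensity fun y => ENNReal.ofReal (1 - Real.cos ⟪η, y⟫)).map (fun y => -y)
      = (Q.ν x).withDensity fun y => ENNReal.ofReal (1 - Real.cos ⟪η, y⟫) := by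
  set w : Space d → ℝ := fun y => 1 - Real.cos ⟪η, y⟫ with hw
  have hwm : Measurable w := by fun_prop
  have hw0 : ∀ y, 0 ≤ w y := fun y => by
    have := Real.cos_le_one ⟪η, y⟫; simp only [hw]; linarith
  have hwi : Integrable w (Q.ν x) := Q.integrable_one_sub_cos x η
  -- The weight makes the measure finite, so its characteristic function determines it.
  have hfin : IsFiniteMeasure ((Q.ν x).withDensity fun y => ENNReal.ofReal (w y)) :=
    isFiniteMeasure_withDensity_ofReal hwi.2
  have hfin' := Measure.isFiniteMeasure_map
    ((Q.ν x).withDensity fun y => ENNReal.ofReal (w y)) (fun y => -y)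
  have hsin : ∀ ξ, ∫ y, Real.sin ⟪ξ, y⟫ * w y ∂(Q.ν x) = 0 := by
    intro ξ
    have hi : ∀ ζ, Integrable (fun y => (symbolIntegrand ζ y).im) (Q.ν x) := fun ζ =>
      (Q.integrable_symbolIntegrand x ζ).im
    -- A second difference in `ξ` with step `η`: it produces the factor `1 - cos⟨η,y⟩` and cancels
    -- the linear compensator.
    have hpt : ∀ y, Real.sin ⟪ξ, y⟫ * w y = 1 / 2 * ((symbolIntegrand (ξ + η) y).im
        + (symbolIntegrand (ξ - η) y).im - 2 * (symbolIntegrand ξ y).im) := by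
      intro y
      simp only [symbolIntegrand_im, hw]
      have e : (Metric.ball (0 : Space d) 1).indicator (fun y => (⟪ξ + η, y⟫ : ℝ)) y
          + (Metric.ball (0 : Space d) 1).indicator (fun y => (⟪ξ - η, y⟫ : ℝ)) y
          - 2 * (Metric.ball (0 : Space d) 1).indicator (fun y => (⟪ξ, y⟫ : ℝ)) y = 0 := by
        by_cases hy : y ∈ Metric.ball (0 : Space d) 1
        · simp only [Set.indicator_of_mem hy, inner_add_left, inner_sub_left]; ring
        · simp only [Set.indicator_of_notMem hy]; ring
      rw [inner_add_left, inner_sub_left, Real.sin_add, Real.sin_sub]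
      linear_combination -1 / 2 * e
    simp_rw [hpt]
    rw [integral_const_mul, integral_sub (((hi _).add (hi _) :) : Integrable (fun y => _ + _) _) ((hi _).const_mul 2),
      integral_add (hi _) (hi _), integral_const_mul]
    have h1 := him (ξ + η)
    have h2 := him (ξ - η)
    have h3 := him ξ
    rw [symbol_im] at h1 h2 h3
    rw [inner_add_left] at h1
    rw [inner_sub_left] at h2
    linarith
  refine Measure.ext_of_charFun (funext fun ξ => ?_)
  rw [charFun_apply, charFun_apply, integral_map (by fun_prop) (by fun_prop)]
  have hcd : ∀ f : Space d → ℂ, ∫ y, f y ∂((Q.ν x).withDensity fun y => ENNReal.ofReal (w y))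
      = ∫ y, w y • f y ∂(Q.ν x) := by
    intro f
    rw [integral_withDensity_eq_integral_toReal_smul (by fun_prop) (by simp)]
    simp_rw [ENNReal.toReal_ofReal (hw0 _)]
  rw [hcd, hcd, ← sub_eq_zero]
  have hie : ∀ s : ℝ, Integrable
      (fun y => w y • Complex.exp (((s * ⟪y, ξ⟫ : ℝ) : ℂ) * Complex.I)) (Q.ν x) := by
    intro s
    refine hwi.smul_bdd (C := 1) ?_ ?_
    · fun_prop
    · exact ae_of_all _ fun y => (Complex.norm_exp_ofReal_mul_I _).le
  have h1 := hie (-1)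
  have h2 := hie 1
  simp only [neg_mul, one_mul] at h1 h2
  simp only [inner_neg_left]
  rw [← integral_sub h1 h2]
  have : ∀ y, w y • Complex.exp (((-⟪y, ξ⟫ : ℝ) : ℂ) * Complex.I)
      - w y • Complex.exp (((⟪y, ξ⟫ : ℝ) : ℂ) * Complex.I)
      = (-2 * Complex.I) * ((Real.sin ⟪ξ, y⟫ * w y : ℝ) : ℂ) := by
    intro y
    rw [Complex.exp_mul_I, Complex.exp_mul_I, ← Complex.ofReal_cos, ← Complex.ofReal_cos,
      ← Complex.ofReal_sin, ← Complex.ofReal_sin, Real.cos_neg, Real.sin_neg,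
      real_inner_comm ξ y, Complex.real_smul, Complex.real_smul]
    push_cast
    ring
  simp_rw [this]
  rw [integral_const_mul, integral_complex_ofReal, hsin]
  simp

/-- The tails of a coordinate of the Lévy measure of a real symbol are symmetric. -/
lemma measure_lt_neg_coord_of_im_eq_zero {x : Space d} (him : ∀ ξ, (Q.symbol x ξ).im = 0)
    (i : Fin d) {u : ℝ} (hu : 0 ≤ u) :
    Q.ν x {y | u < -y i} = Q.ν x {y | u < y i} := by
  have hN : ∀ n : ℕ, Q.ν x {y | u < -y i ∧ -y i < n} = Q.ν x {y | u < y i ∧ y i < n} := by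
    intro n
    rcases Nat.eq_zero_or_pos n with rfl | hn
    · have e : ∀ t : ℝ, ¬ (u < t ∧ t < ((0 : ℕ) : ℝ)) := fun t h => by
        have := h.2; push_cast at this; linarith [h.1]
      have e1 : {y : Space d | u < -y i ∧ -y i < ((0 : ℕ) : ℝ)} = ∅ := by
        ext y; simp only [Set.mem_ofPred_eq, e, Set.mem_empty_iff_false]
      have e2 : {y : Space d | u < y i ∧ y i < ((0 : ℕ) : ℝ)} = ∅ := by
        ext y; simp only [Set.mem_ofPred_eq, e, Set.mem_empty_iff_false]
      rw [e1, e2]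
    have hn0 : (0 : ℝ) < n := by exact_mod_cast hn
    -- On the slab `u < y i < n` this gives `0 < ⟨η,y⟩ < 1`, so the weight is positive there and can
    -- be divided out.
    set η : Space d := EuclideanSpace.single i (1 / (n : ℝ)) with hη
    have hin : ∀ y : Space d, (⟪η, y⟫ : ℝ) = y i / n := fun y => by
      rw [hη, EuclideanSpace.inner_single_left]; simp; ring
    set w : Space d → ℝ≥0∞ := fun y => ENNReal.ofReal (1 - Real.cos ⟪η, y⟫) with hw
    have hwm : Measurable w := by fun_prop
    have hwneg : ∀ y, w (-y) = w y := fun y => by simp [hw]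
    have hsym := Q.symmetric_withDensity_of_im_eq_zero him η
    set S : Set (Space d) := {y | u < y i ∧ y i < n} with hS
    have hcoord : Measurable fun y : Space d => y i := by fun_prop
    have hSm : MeasurableSet S :=
      (measurableSet_lt measurable_const hcoord).inter (measurableSet_lt hcoord measurable_const)
    have hwpos : ∀ y ∈ S, w y ≠ 0 := by
      intro y hy
      have h1 : 0 < y i / n := div_pos (lt_of_le_of_lt hu hy.1) hn0
      have h2 : y i / n < 1 := (div_lt_one hn0).2 hy.2
      have h3 : Real.cos (y i / n) < 1 := by
        rw [← Real.cos_zero]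
        exact Real.cos_lt_cos_of_nonneg_of_le_pi le_rfl (by linarith [Real.pi_gt_three]) h1
      simp only [hw, hin, ne_eq, ENNReal.ofReal_eq_zero, not_le]
      linarith
    have key : ∀ f : Space d → ℝ≥0∞, Measurable f →
        ∫⁻ y, w y * f (-y) ∂(Q.ν x) = ∫⁻ y, w y * f y ∂(Q.ν x) := by
      intro f hf
      have e1 := lintegral_withDensity_eq_lintegral_mul (Q.ν x) hwm hf
      have e2 := lintegral_withDensity_eq_lintegral_mul (Q.ν x) hwm (hf.comp measurable_neg)
      simp only [Pi.mul_apply, Function.comp_apply] at e1 e2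
      rw [← e1, ← e2, ← lintegral_map hf measurable_neg]
      exact congrArg (fun m => ∫⁻ y, f y ∂m) hsym
    have hk := key (S.indicator fun y => (w y)⁻¹) (hwm.inv.indicator hSm)
    have e1 : ∀ y, w y * S.indicator (fun y => (w y)⁻¹) y = S.indicator 1 y := by
      intro y
      by_cases hy : y ∈ S
      · rw [Set.indicator_of_mem hy, Set.indicator_of_mem hy]
        exact ENNReal.mul_inv_cancel (hwpos y hy) ENNReal.ofReal_ne_top
      · rw [Set.indicator_of_notMem hy, Set.indicator_of_notMem hy, mul_zero]
    have e2 : ∀ y, w y * S.indicator (fun y => (w y)⁻¹) (-y) = S.indicator 1 (-y) := by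
      intro y
      rw [← hwneg y]; exact e1 (-y)
    simp_rw [e1, e2] at hk
    rw [lintegral_indicator_one hSm] at hk
    rw [← hk]
    have : ∀ y : Space d, S.indicator (1 : Space d → ℝ≥0∞) (-y)
        = ((fun y => -y) ⁻¹' S).indicator 1 y := fun y => rfl
    simp_rw [this]
    rw [lintegral_indicator_one (measurable_neg hSm)]
    rfl
  have hU : ∀ f : Space d → ℝ, {y | u < f y} = ⋃ n : ℕ, {y | u < f y ∧ f y < n} := by
    intro f
    ext y
    simp only [Set.mem_ofPred_eq, Set.mem_iUnion, exists_and_left]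
    exact ⟨fun h => ⟨h, exists_nat_gt _⟩, fun h => h.1⟩
  have hmono : ∀ f : Space d → ℝ, Monotone fun n : ℕ => {y | u < f y ∧ f y < n} :=
    fun f m n hmn y hy => ⟨hy.1, hy.2.trans_le (by exact_mod_cast hmn)⟩
  rw [hU fun y => -y i, hU fun y => y i, (hmono _).measure_iUnion, (hmono _).measure_iUnion]
  exact iSup_congr hN

end Symbol

end LevyQuadruple

/-! ### Radial symbols in the plane -/

lemma IsRadialSymbol.rotation_eq {q : Space 2 → Space 2 → ℂ} (hq : IsRadialSymbol q)
    (x : Space 2) (φ : ℝ) (ξ : Space 2) : q x (rotation φ ξ) = q x ξ := by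
  have h := hq x (toIcoMod Real.two_pi_pos 0 φ)
    (by simpa using toIcoMod_mem_Ico Real.two_pi_pos 0 φ) ξ
  rw [← h]
  unfold rotation toIcoMod
  simp only [zsmul_eq_mul, Real.cos_sub_int_mul_two_pi, Real.sin_sub_int_mul_two_pi]

lemma rotation_pi (ξ : Space 2) : rotation Real.pi ξ = -ξ := by
  ext i
  fin_cases i <;> simp [rotation]

lemma exists_rotation_eq (ξ : Space 2) :
    ∃ φ, rotation φ (EuclideanSpace.single 0 ‖ξ‖) = ξ := by
  set z : ℂ := ⟨ξ 0, ξ 1⟩ with hz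
  have hn : ‖z‖ = ‖ξ‖ := by
    rw [EuclideanSpace.norm_eq, Fin.sum_univ_two, Complex.norm_def, Complex.normSq_apply]
    simp [hz, sq]
  refine ⟨z.arg, ?_⟩
  have h0 : ‖ξ‖ * Real.cos z.arg = ξ 0 := by rw [← hn, Complex.norm_mul_cos_arg]
  have h1 : ‖ξ‖ * Real.sin z.arg = ξ 1 := by rw [← hn, Complex.norm_mul_sin_arg]
  ext i
  fin_cases i <;> simp [rotation, ← h0, ← h1, mul_comm]

lemma inner_rotation (φ : ℝ) (ξ y : Space 2) : (⟪rotation φ ξ, y⟫ : ℝ)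
    = (ξ 0 * y 0 + ξ 1 * y 1) * Real.cos φ + (ξ 0 * y 1 - ξ 1 * y 0) * Real.sin φ := by
  rw [PiLp.inner_apply, Fin.sum_univ_two]
  simp [rotation]
  ring

lemma sq_add_sq_eq_norm_sq_mul (ξ y : Space 2) :
    (ξ 0 * y 0 + ξ 1 * y 1) ^ 2 + (ξ 0 * y 1 - ξ 1 * y 0) ^ 2 = ‖ξ‖ ^ 2 * ‖y‖ ^ 2 := by
  rw [EuclideanSpace.real_norm_sq_eq, EuclideanSpace.real_norm_sq_eq, Fin.sum_univ_two,
    Fin.sum_univ_two]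
  ring

/-! ### Two-sided bounds for radial symbols by truncated second moments -/

namespace LevyQuadruple

variable (Q : LevyQuadruple 2)

/-- Rotation by `π` is `ξ ↦ -ξ`, so the imaginary part is both even and odd. -/
lemma symbol_im_eq_zero (hq : IsRadialSymbol Q.symbol) (x ξ : Space 2) :
    (Q.symbol x ξ).im = 0 := by
  have h := Q.symbol_neg_im x ξ
  rw [← rotation_pi, hq.rotation_eq] at h
  linarith

/-- The truncated second moment `∫ min(1, |ξ|²|y|²) ν(x,dy)`. -/
noncomputable def truncMoment (x ξ : Space 2) : ℝ≥0∞ :=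
  ∫⁻ y, ENNReal.ofReal (min 1 (‖ξ‖ ^ 2 * ‖y‖ ^ 2)) ∂(Q.ν x)

/-- A radial symbol dominates the truncated second moment of its Lévy measure. -/
lemma truncMoment_le_symbol (hq : IsRadialSymbol Q.symbol) (x ξ : Space 2) :
    Q.truncMoment x ξ ≤ 80 * ENNReal.ofReal (Q.symbol x ξ).re := by
  have hmeas : Measurable fun p : Space 2 × ℝ =>
      ENNReal.ofReal (1 - Real.cos ⟪rotation p.2 ξ, p.1⟫) := by
    simp_rw [inner_rotation]
    fun_prop
  have h1 : ∀ y : Space 2, ENNReal.ofReal (1 / 10) * ENNReal.ofReal (min 1 (‖ξ‖ ^ 2 * ‖y‖ ^ 2))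
      ≤ ∫⁻ φ in Set.Ioc 0 (2 * Real.pi), ENNReal.ofReal (1 - Real.cos ⟪rotation φ ξ, y⟫) := by
    intro y
    have hc : Continuous fun φ => 1 - Real.cos ⟪rotation φ ξ, y⟫ := by
      simp_rw [inner_rotation]; fun_prop
    rw [← ofReal_integral_eq_lintegral_ofReal
      (hc.integrableOn_Ioc) (ae_of_all _ fun φ => by
        have := Real.cos_le_one ⟪rotation φ ξ, y⟫; simp only [Pi.zero_apply]; linarith),
      ← intervalIntegral.integral_of_le Real.two_pi_pos.le, ← ENNReal.ofReal_mul (by norm_num)]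
    apply ENNReal.ofReal_le_ofReal
    simp_rw [inner_rotation]
    refine le_trans (le_of_eq ?_) (min_one_sq_le_integral_one_sub_cos _ _)
    rw [sq_add_sq_eq_norm_sq_mul]
    ring
  -- Here 8 bounds the circle length `2π`, and 80 = 8 · 10. After the Tonelli swap, radiality bounds
  -- the inner integral by the same value for every angle.
  have h2 : ENNReal.ofReal (1 / 10) * Q.truncMoment x ξ
      ≤ ENNReal.ofReal 8 * ENNReal.ofReal (Q.symbol x ξ).re := by
    calc _ = ∫⁻ y, ENNReal.ofReal (1 / 10)
              * ENNReal.ofReal (min 1 (‖ξ‖ ^ 2 * ‖y‖ ^ 2)) ∂(Q.ν x) := by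
            rw [truncMoment, lintegral_const_mul _ (by fun_prop)]
      _ ≤ ∫⁻ y, (∫⁻ φ in Set.Ioc 0 (2 * Real.pi),
            ENNReal.ofReal (1 - Real.cos ⟪rotation φ ξ, y⟫)) ∂(Q.ν x) := lintegral_mono h1
      _ = ∫⁻ φ in Set.Ioc 0 (2 * Real.pi), ∫⁻ y,
            ENNReal.ofReal (1 - Real.cos ⟪rotation φ ξ, y⟫) ∂(Q.ν x) :=
          lintegral_lintegral_swap hmeas.aemeasurable
      _ ≤ ∫⁻ φ in Set.Ioc 0 (2 * Real.pi), ENNReal.ofReal (Q.symbol x ξ).re := by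
          refine lintegral_mono fun φ => ?_
          rw [← hq.rotation_eq x φ ξ]
          exact Q.lintegral_one_sub_cos_le_symbol x _
      _ ≤ _ := by
          rw [setLIntegral_const, Real.volume_Ioc, mul_comm]
          gcongr
          linarith [Real.pi_lt_four]
  calc Q.truncMoment x ξ
      = ENNReal.ofReal 10 * (ENNReal.ofReal (1 / 10) * Q.truncMoment x ξ) := by
        rw [← mul_assoc, ← ENNReal.ofReal_mul (by norm_num)]; norm_num
    _ ≤ ENNReal.ofReal 10 * (ENNReal.ofReal 8 * ENNReal.ofReal (Q.symbol x ξ).re) := by gcongr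
    _ = _ := by
        rw [← mul_assoc, ← ENNReal.ofReal_mul (by norm_num)]; norm_num

lemma symbol_single_re (x : Space 2) (ρ : ℝ) :
    ENNReal.ofReal (Q.symbol x (EuclideanSpace.single 0 ρ)).re
      = ENNReal.ofReal (Q.a x + 1 / 2 * (ρ ^ 2 * Q.C x 0 0))
        + ∫⁻ y, ENNReal.ofReal (1 - Real.cos (ρ * y 0)) ∂(Q.ν x) := by
  rw [ofReal_symbol_re]
  have h1 : dotProduct (EuclideanSpace.single 0 ρ : Space 2).ofLp
      ((Q.C x).mulVec (EuclideanSpace.single 0 ρ : Space 2).ofLp) = ρ ^ 2 * Q.C x 0 0 := by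
    simp [dotProduct, Matrix.mulVec]
    ring
  have h2 : ∀ y : Space 2, (⟪EuclideanSpace.single 0 ρ, y⟫ : ℝ) = ρ * y 0 := fun y => by
    rw [EuclideanSpace.inner_single_left]; simp
  simp_rw [h1, h2]

lemma C_zero_zero_nonneg (x : Space 2) : 0 ≤ Q.C x 0 0 := (Q.posSemidef_C x).diag_nonneg

lemma a_eq_zero (h0 : ∀ x, Q.symbol x 0 = 0) (x : Space 2) : Q.a x = 0 := by
  have h := congrArg Complex.re (h0 x)
  rw [symbol_re] at h
  simpa using h

/-- A radial symbol without killing is controlled by the first coordinate of the jumps. -/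
lemma symbol_re_le (hq : IsRadialSymbol Q.symbol) (h0 : ∀ x, Q.symbol x 0 = 0) (x ξ : Space 2) :
    ENNReal.ofReal (Q.symbol x ξ).re
      ≤ ENNReal.ofReal (‖ξ‖ ^ 2) * ENNReal.ofReal (1 / 2 * Q.C x 0 0)
        + 2 * ∫⁻ y, ENNReal.ofReal (min 1 (‖ξ‖ ^ 2 * y 0 ^ 2)) ∂(Q.ν x) := by
  obtain ⟨φ, hφ⟩ := exists_rotation_eq ξ
  have h : Q.symbol x ξ = Q.symbol x (EuclideanSpace.single 0 ‖ξ‖) := by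
    conv_lhs => rw [← hφ]
    exact hq.rotation_eq x φ _
  rw [h, symbol_single_re, Q.a_eq_zero h0, ← ENNReal.ofReal_mul (by positivity),
    ← lintegral_const_mul _ (by fun_prop)]
  refine add_le_add (le_of_eq (by congr 1; ring)) (lintegral_mono fun y => ?_)
  have h2 : (2 : ℝ≥0∞) = ENNReal.ofReal 2 := by norm_num
  refine (ENNReal.ofReal_le_ofReal (one_sub_cos_le_two_mul_min (‖ξ‖ * y 0))).trans (le_of_eq ?_)
  rw [ENNReal.ofReal_mul (by norm_num), ← h2, mul_pow]

/-- The growth bound at a unit vector is `2c`, and the jump part only adds to the real part; hence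
uniformity in `x`. -/
lemma half_C_zero_zero_le {c : ℝ} (hc : ∀ x ξ, ‖Q.symbol x ξ‖ ≤ c * (1 + ‖ξ‖ ^ 2))
    (x : Space 2) : ENNReal.ofReal (1 / 2 * Q.C x 0 0) ≤ ENNReal.ofReal (2 * c) := by
  have h := hc x (EuclideanSpace.single 0 1)
  have h1 := Q.symbol_single_re x 1
  have h2 : (Q.symbol x (EuclideanSpace.single 0 1)).re ≤ 2 * c := by
    refine (Complex.re_le_norm _).trans (h.trans (le_of_eq ?_))
    simp; ring
  refine le_trans ?_ (ENNReal.ofReal_le_ofReal h2)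
  rw [h1]
  refine le_trans (ENNReal.ofReal_le_ofReal ?_) le_self_add
  linarith [Q.nonneg_a x]

/-- The same evaluation at a unit vector, now through `truncMoment_le_symbol`; it controls jumps
below the tail threshold uniformly in `x`. -/
lemma lintegral_min_one_norm_sq_le (hq : IsRadialSymbol Q.symbol) {c : ℝ}
    (hc : ∀ x ξ, ‖Q.symbol x ξ‖ ≤ c * (1 + ‖ξ‖ ^ 2)) (x : Space 2) :
    ∫⁻ y, ENNReal.ofReal (min 1 (‖y‖ ^ 2)) ∂(Q.ν x) ≤ 80 * ENNReal.ofReal (2 * c) := by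
  have h := Q.truncMoment_le_symbol hq x (EuclideanSpace.single 0 1)
  simp only [truncMoment, PiLp.norm_single, norm_one, one_pow, one_mul] at h
  refine h.trans ?_
  gcongr
  refine (Complex.re_le_norm _).trans ((hc x _).trans (le_of_eq ?_))
  simp; ring

/-- Comparison of radial symbols from a comparison of the tails of their Lévy measures, measured
by a function `g` between the first coordinate and the norm. -/
lemma exists_symbol_re_le_of_tail_le (Q' : LevyQuadruple 2) (hq' : IsRadialSymbol Q'.symbol)
    (h0 : ∀ x, Q'.symbol x 0 = 0) {c : ℝ} (hc : ∀ x ξ, ‖Q'.symbol x ξ‖ ≤ c * (1 + ‖ξ‖ ^ 2))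
    {g : Space 2 → ℝ} (hg : Measurable g) (hg0 : ∀ y, |y 0| ≤ g y) (hg1 : ∀ y, g y ≤ ‖y‖)
    {u₀ : ℝ} {k : ℝ≥0∞} (hk : k ≠ ⊤)
    (htail : ∀ x u, u₀ ≤ u → Q'.ν x {y | u < g y} ≤ k * Q.ν x {y | u < g y}) :
    ∃ K : ℝ≥0∞, K ≠ ⊤ ∧ ∀ x ξ, ENNReal.ofReal (Q'.symbol x ξ).re
      ≤ K * (ENNReal.ofReal (‖ξ‖ ^ 2) + Q.truncMoment x ξ) := by
  -- Being at least `u₀` permits the tail comparison; being at least 1 gives `min(g, v)² ≤ v² min(1,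
  -- |y|²)`.
  set v := max u₀ 1 with hv
  have hv1 : 1 ≤ v := le_max_right _ _
  set D := ENNReal.ofReal (2 * c)
  set D' := 2 * (ENNReal.ofReal (v ^ 2) * (80 * D))
  have hD : D ≠ ⊤ := ENNReal.ofReal_ne_top
  have hD' : D' ≠ ⊤ := by
    refine ENNReal.mul_ne_top (by norm_num) (ENNReal.mul_ne_top ENNReal.ofReal_ne_top
      (ENNReal.mul_ne_top (by norm_num) hD))
  refine ⟨D + D' + 2 * k, by finiteness, fun x ξ => ?_⟩
  have hgn : ∀ y, 0 ≤ g y := fun y => (abs_nonneg _).trans (hg0 y)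
  have h1 : ∫⁻ y, ENNReal.ofReal (min 1 (‖ξ‖ ^ 2 * y 0 ^ 2)) ∂(Q'.ν x)
      ≤ ∫⁻ y, ENNReal.ofReal (min 1 (‖ξ‖ ^ 2 * g y ^ 2)) ∂(Q'.ν x) := by
    refine lintegral_mono fun y => ENNReal.ofReal_le_ofReal ?_
    gcongr min 1 (‖ξ‖ ^ 2 * ?_)
    rw [← sq_abs]
    gcongr
    exact hg0 y
  have h2 := lintegral_min_one_sq_le_of_tail_le hg hgn
    (fun u hu => htail x u ((le_max_left _ _).trans hu)) (norm_nonneg ξ) (v := v)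
  have h3 : ∫⁻ y, ENNReal.ofReal (‖ξ‖ ^ 2 * min (g y) v ^ 2) ∂(Q'.ν x)
      ≤ ENNReal.ofReal (‖ξ‖ ^ 2) * (ENNReal.ofReal (v ^ 2) * (80 * D)) := by
    calc _ ≤ ∫⁻ y, ENNReal.ofReal (‖ξ‖ ^ 2) * (ENNReal.ofReal (v ^ 2)
              * ENNReal.ofReal (min 1 (‖y‖ ^ 2))) ∂(Q'.ν x) := by
            refine lintegral_mono fun y => ?_
            rw [← ENNReal.ofReal_mul (by positivity), ← ENNReal.ofReal_mul (by positivity)]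
            apply ENNReal.ofReal_le_ofReal
            gcongr
            rcases le_total 1 (‖y‖ ^ 2) with h | h
            · rw [min_eq_left h, mul_one]
              have := hgn y
              gcongr
              exact min_le_right _ _
            · rw [min_eq_right h, ← mul_pow]
              have := hgn y
              gcongr
              exact (min_le_left _ _).trans ((hg1 y).trans
                (le_mul_of_one_le_left (norm_nonneg y) hv1))
      _ = ENNReal.ofReal (‖ξ‖ ^ 2) * (ENNReal.ofReal (v ^ 2)
              * ∫⁻ y, ENNReal.ofReal (min 1 (‖y‖ ^ 2)) ∂(Q'.ν x)) := by
            rw [lintegral_const_mul _ (by fun_prop), lintegral_const_mul _ (by fun_prop)]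
      _ ≤ _ := by
            gcongr
            exact Q'.lintegral_min_one_norm_sq_le hq' hc x
  have h4 : ∫⁻ y, ENNReal.ofReal (min 1 (‖ξ‖ ^ 2 * g y ^ 2)) ∂(Q.ν x) ≤ Q.truncMoment x ξ := by
    refine lintegral_mono fun y => ENNReal.ofReal_le_ofReal ?_
    have := hgn y
    gcongr
    exact hg1 y
  calc ENNReal.ofReal (Q'.symbol x ξ).re
      ≤ ENNReal.ofReal (‖ξ‖ ^ 2) * D + 2 * (ENNReal.ofReal (‖ξ‖ ^ 2)
          * (ENNReal.ofReal (v ^ 2) * (80 * D)) + k * Q.truncMoment x ξ) := by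
        refine (Q'.symbol_re_le hq' h0 x ξ).trans ?_
        gcongr
        · exact Q'.half_C_zero_zero_le hc x
        · refine h1.trans (h2.trans ?_)
          gcongr
    _ = (D + D') * ENNReal.ofReal (‖ξ‖ ^ 2) + 2 * k * Q.truncMoment x ξ := by ring
    _ ≤ (D + D' + 2 * k) * ENNReal.ofReal (‖ξ‖ ^ 2)
          + (D + D' + 2 * k) * Q.truncMoment x ξ := by
        exact add_le_add (mul_le_mul_left le_self_add _) (mul_le_mul_left le_add_self _)
    _ = _ := by ring

/-- A Lévy measure with dominated radial tails or dominated first-coordinate tails has a radial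
symbol dominated by the truncated second moment. -/
lemma exists_symbol_re_le (Q' : LevyQuadruple 2) (hq' : IsRadialSymbol Q'.symbol)
    (h0 : ∀ x, Q'.symbol x 0 = 0) {c : ℝ} (hc : ∀ x ξ, ‖Q'.symbol x ξ‖ ≤ c * (1 + ‖ξ‖ ^ 2))
    {u₀ : ℝ} (hu₀ : 0 ≤ u₀)
    (htail : (∀ x, ∀ u, u₀ ≤ u →
        Q'.ν x (Metric.ball (0 : Space 2) u)ᶜ ≤ Q.ν x (Metric.ball (0 : Space 2) u)ᶜ) ∨
      (∀ x, ∀ u, u₀ ≤ u → Q'.ν x {y : Space 2 | u < y 0} ≤ Q.ν x {y : Space 2 | u < y 0})) :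
    ∃ K : ℝ≥0∞, K ≠ ⊤ ∧ ∀ x ξ, ENNReal.ofReal (Q'.symbol x ξ).re
      ≤ K * (ENNReal.ofReal (‖ξ‖ ^ 2) + Q.truncMoment x ξ) := by
  have hcoord : ∀ y : Space 2, |y 0| ≤ ‖y‖ := fun y => by
    simpa using PiLp.norm_apply_le y 0
  rcases htail with h | h
  · refine Q.exists_symbol_re_le_of_tail_le Q' hq' h0 hc measurable_norm hcoord (fun y => le_rfl)
      (u₀ := u₀) ENNReal.one_ne_top fun x u hu => ?_
    -- The hypothesis concerns `|y| ≥ u`; the strict tail is an increasing union of such sets with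
    -- larger radii.
    have hU : {y : Space 2 | u < ‖y‖}
        = ⋃ n : ℕ, (Metric.ball (0 : Space 2) (u + 1 / ((n : ℝ) + 1)))ᶜ := by
      ext y
      simp only [Set.mem_ofPred_eq, Set.mem_iUnion, Set.mem_compl_iff, mem_ball_zero_iff, not_lt]
      constructor
      · intro hy
        obtain ⟨n, hn⟩ := exists_nat_one_div_lt (sub_pos.2 hy)
        exact ⟨n, by linarith⟩
      · rintro ⟨n, hn⟩
        have : 0 < 1 / ((n : ℝ) + 1) := by positivity
        linarith
    have hm : Monotone fun n : ℕ => (Metric.ball (0 : Space 2) (u + 1 / ((n : ℝ) + 1)))ᶜ := by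
      intro m n hmn
      refine Set.compl_subset_compl.2 (Metric.ball_subset_ball ?_)
      gcongr
    rw [one_mul, hU, hm.measure_iUnion, hm.measure_iUnion]
    refine iSup_mono fun n => h x _ ?_
    have : 0 < 1 / ((n : ℝ) + 1) := by positivity
    linarith
  -- The factor 2 comes from symmetry of the dominated measure, which turns its two-sided tail into
  -- twice the one-sided tail.
  · have hm : Measurable fun y : Space 2 => |y 0| := by fun_prop
    refine Q.exists_symbol_re_le_of_tail_le Q' hq' h0 hc hm (fun y => le_rfl) hcoord
      (u₀ := u₀) (k := 2) (by norm_num) fun x u hu => ?_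
    have hU : {y : Space 2 | u < |y 0|} = {y | u < y 0} ∪ {y | u < -y 0} := by
      ext y; simp only [Set.mem_ofPred_eq, lt_abs, Set.mem_union]
    calc Q'.ν x {y : Space 2 | u < |y 0|}
        ≤ Q'.ν x {y | u < y 0} + Q'.ν x {y | u < -y 0} := by
          rw [hU]; exact measure_union_le _ _
      _ = 2 * Q'.ν x {y | u < y 0} := by
          rw [Q'.measure_lt_neg_coord_of_im_eq_zero (Q'.symbol_im_eq_zero hq' x) 0
            (hu₀.trans hu), two_mul]
      _ ≤ 2 * Q.ν x {y | u < y 0} := mul_le_mul_right (h x u hu) 2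
      _ ≤ 2 * Q.ν x {y | u < |y 0|} := by
          gcongr with y
          exact le_abs_self _

end LevyQuadruple

/-! ### Comparison of the integrals -/

/-- Only `L` must be nonzero and finite, so that it cancels; `s` and `s'` may take the values 0 and
`∞`. -/
lemma setLIntegral_inv_le_mul {α : Type*} [MeasurableSpace α] {μ : Measure α} {A : Set α}
    (hA : MeasurableSet A) {s s' : α → ℝ≥0∞} {L : ℝ≥0∞} (hL0 : L ≠ 0) (hL : L ≠ ⊤)
    (h : ∀ ξ ∈ A, s' ξ ≤ L * s ξ) :
    ∫⁻ ξ in A, (s ξ)⁻¹ ∂μ ≤ L * ∫⁻ ξ in A, (s' ξ)⁻¹ ∂μ := by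
  rw [← lintegral_const_mul' _ _ hL]
  refine setLIntegral_mono' hA fun ξ hξ => ?_
  have h1 := ENNReal.inv_le_inv.2 (h ξ hξ)
  rw [ENNReal.mul_inv (Or.inl hL0) (Or.inl hL)] at h1
  calc (s ξ)⁻¹ = L * (L⁻¹ * (s ξ)⁻¹) := by
        rw [← mul_assoc, ENNReal.mul_inv_cancel hL0 hL, one_mul]
    _ ≤ L * (s' ξ)⁻¹ := by gcongr

/-! ### Absorbing the quadratic term -/

namespace LevyQuadruple

variable (Q : LevyQuadruple 2)

/-- Unless all Lévy measures vanish, the supremum of the truncated second moments dominates `|ξ|²`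
on the unit ball. -/
lemma exists_norm_sq_le_iSup_truncMoment (hν : ∃ x, Q.ν x ≠ 0) :
    ∃ L : ℝ≥0∞, L ≠ ⊤ ∧ ∀ ξ : Space 2, ‖ξ‖ ≤ 1 →
      ENNReal.ofReal (‖ξ‖ ^ 2) ≤ L * ⨆ x, Q.truncMoment x ξ := by
  obtain ⟨x, hx⟩ := hν
  set m := ∫⁻ y, ENNReal.ofReal (min 1 (‖y‖ ^ 2)) ∂(Q.ν x) with hm
  have hm0 : m ≠ 0 := by
    intro h
    rw [hm, lintegral_eq_zero_iff (by fun_prop)] at h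
    apply hx
    rw [← ae_eq_bot, ← eventually_false_iff_eq_bot]
    filter_upwards [h, Q.ae_ne_zero x] with y hy hy0
    simp [hy0] at hy
  have hmt : m ≠ ⊤ := (Q.ν_integrable x).ne
  refine ⟨m⁻¹, ENNReal.inv_ne_top.2 hm0, fun ξ hξ => ?_⟩
  -- For `|ξ| ≤ 1`, `|ξ|² min(1, |y|²) ≤ min(1, |ξ|²|y|²)`.
  have h1 : ENNReal.ofReal (‖ξ‖ ^ 2) * m ≤ Q.truncMoment x ξ := by
    rw [hm, ← lintegral_const_mul _ (by fun_prop)]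
    refine lintegral_mono fun y => ?_
    rw [← ENNReal.ofReal_mul (by positivity)]
    apply ENNReal.ofReal_le_ofReal
    rw [mul_min_of_nonneg _ _ (by positivity), mul_one]
    refine min_le_min_right _ ?_
    have := norm_nonneg ξ
    nlinarith
  calc ENNReal.ofReal (‖ξ‖ ^ 2) = m⁻¹ * (ENNReal.ofReal (‖ξ‖ ^ 2) * m) := by
        rw [mul_comm, mul_assoc, ENNReal.mul_inv_cancel hm0 hmt, mul_one]
    _ ≤ m⁻¹ * ⨆ x, Q.truncMoment x ξ := by
        gcongr
        exact h1.trans (le_iSup (fun x => Q.truncMoment x ξ) x)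

lemma integralInvSup_eq_top (hq : IsRadialSymbol Q.symbol) {q' : Space 2 → Space 2 → ℂ}
    {K : ℝ≥0∞} (hK : K ≠ ⊤) (hle : ∀ x ξ, ENNReal.ofReal (q' x ξ).re
      ≤ K * (ENNReal.ofReal (‖ξ‖ ^ 2) + Q.truncMoment x ξ))
    (htop : ∀ r : ℝ, 0 < r → integralInvSup Q.symbol r = ⊤) {r : ℝ} (hr : 0 < r) :
    integralInvSup q' r = ⊤ := by
  by_cases hν : ∃ x, Q.ν x ≠ 0
  · obtain ⟨L, hL, hLle⟩ := Q.exists_norm_sq_le_iSup_truncMoment hν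
    -- The added 1 keeps the constant nonzero.
    set N := K * (L + 1) * 80 + 1
    have hN : N ≠ ⊤ := by finiteness
    have hN0 : N ≠ 0 := by simp [N]
    have hsup : ∀ ξ ∈ Metric.ball (0 : Space 2) (min r 1),
        ⨆ x, ENNReal.ofReal (q' x ξ).re ≤ N * ⨆ x, ENNReal.ofReal (Q.symbol x ξ).re := by
      intro ξ hξ
      have hξ1 : ‖ξ‖ ≤ 1 := by
        rw [mem_ball_zero_iff] at hξ
        exact (hξ.trans_le (min_le_right _ _)).le
      set S := ⨆ x, ENNReal.ofReal (Q.symbol x ξ).re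
      have hM : ⨆ x, Q.truncMoment x ξ ≤ 80 * S := by
        refine iSup_le fun x => (Q.truncMoment_le_symbol hq x ξ).trans ?_
        gcongr
        exact le_iSup (fun x => ENNReal.ofReal (Q.symbol x ξ).re) x
      refine iSup_le fun x => (hle x ξ).trans ?_
      calc K * (ENNReal.ofReal (‖ξ‖ ^ 2) + Q.truncMoment x ξ)
          ≤ K * (L * (⨆ x, Q.truncMoment x ξ) + ⨆ x, Q.truncMoment x ξ) := by
            gcongr
            · exact hLle ξ hξ1
            · exact le_iSup (fun x => Q.truncMoment x ξ) x
        _ ≤ K * (L * (80 * S) + 80 * S) := by gcongr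
        _ = (K * (L + 1) * 80) * S := by ring
        _ ≤ N * S := by gcongr; exact le_self_add
    have h := setLIntegral_inv_le_mul (μ := volume) measurableSet_ball hN0 hN hsup
    have htop' := htop (min r 1) (lt_min hr one_pos)
    unfold integralInvSup at htop' ⊢
    rw [htop', top_le_iff, ENNReal.mul_eq_top] at h
    have h' : ∫⁻ ξ in Metric.ball (0 : Space 2) (min r 1),
        (⨆ x, ENNReal.ofReal (q' x ξ).re)⁻¹ = ⊤ := by tauto
    exact top_le_iff.1 (h'.ge.trans
      (lintegral_mono_set (Metric.ball_subset_ball (min_le_left _ _))))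
  -- Without jumps, `q'` is at most a multiple of `|ξ|²`, and divergence follows from that alone.
  · push Not at hν
    have hM : ∀ x ξ, Q.truncMoment x ξ = 0 := fun x ξ => by simp [truncMoment, hν]
    have hsup : ∀ ξ ∈ Metric.ball (0 : Space 2) r,
        ⨆ x, ENNReal.ofReal (q' x ξ).re ≤ (K + 1) * ENNReal.ofReal (‖ξ‖ ^ 2) := by
      intro ξ _
      refine iSup_le fun x => (hle x ξ).trans ?_
      rw [hM, add_zero]
      gcongr
      exact le_self_add
    have h := setLIntegral_inv_le_mul (μ := volume) measurableSet_ball (by simp)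
      (by finiteness) hsup
    rw [setLIntegral_inv_norm_sq_eq_top hr, top_le_iff, ENNReal.mul_eq_top] at h
    have hK1 : K + 1 ≠ ⊤ := by finiteness
    unfold integralInvSup
    tauto

/-- Near the origin the normalised integral exceeds 1 simultaneously for all `x`. -/
lemma exists_norm_sq_le_symbol (h : InfiniteLowerSecondMoment Q.ν) :
    ∃ δ : ℝ, 0 < δ ∧ ∀ ξ : Space 2, ‖ξ‖ < δ → ∀ x,
      ENNReal.ofReal (‖ξ‖ ^ 2) ≤ ENNReal.ofReal (Q.symbol x ξ).re := by
  have hev := eventually_lt_of_lt_liminf (b := 1)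
    (show (1 : ℝ≥0∞) < liminf (fun ξ : Space 2 =>
      ⨅ x, ∫⁻ y, ENNReal.ofReal ((1 - Real.cos ⟪ξ, y⟫) / ‖ξ‖ ^ 2) ∂(Q.ν x)) (𝓝[≠] 0) by
      rw [h]; exact ENNReal.one_lt_top)
  rw [eventually_nhdsWithin_iff, Metric.eventually_nhds_iff] at hev
  obtain ⟨δ, hδ, hev⟩ := hev
  refine ⟨δ, hδ, fun ξ hξ x => ?_⟩
  rcases eq_or_ne ξ 0 with rfl | h0
  · simp
  have h1 := (hev (by simpa using hξ) h0).le.trans (iInf_le _ x)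
  have hpos : 0 < ‖ξ‖ ^ 2 := by positivity
  calc ENNReal.ofReal (‖ξ‖ ^ 2) ≤ ENNReal.ofReal (‖ξ‖ ^ 2)
          * ∫⁻ y, ENNReal.ofReal ((1 - Real.cos ⟪ξ, y⟫) / ‖ξ‖ ^ 2) ∂(Q.ν x) :=
        le_mul_of_one_le_right' h1
    _ = ∫⁻ y, ENNReal.ofReal (1 - Real.cos ⟪ξ, y⟫) ∂(Q.ν x) := by
        rw [← lintegral_const_mul _ (by fun_prop)]
        congr with y
        rw [← ENNReal.ofReal_mul hpos.le, mul_div_cancel₀ _ hpos.ne']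
    _ ≤ _ := Q.lintegral_one_sub_cos_le_symbol x ξ

/-- With an infimum over `x`, the term `|ξ|²` has to be absorbed for each `x` separately, which the
moment condition allows. -/
lemma exists_integralInvInf_lt_top (hq : IsRadialSymbol Q.symbol) {q' : Space 2 → Space 2 → ℂ}
    {K : ℝ≥0∞} (hK : K ≠ ⊤) (hle : ∀ x ξ, ENNReal.ofReal (q' x ξ).re
      ≤ K * (ENNReal.ofReal (‖ξ‖ ^ 2) + Q.truncMoment x ξ))
    (hmom : InfiniteLowerSecondMoment Q.ν) {r : ℝ} (hr : 0 < r) (hfin : integralInvInf q' r < ⊤) :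
    ∃ r : ℝ, 0 < r ∧ integralInvInf Q.symbol r < ⊤ := by
  obtain ⟨δ, hδ, hδle⟩ := Q.exists_norm_sq_le_symbol hmom
  -- 81 = 1 + 80: one for `|ξ|²`, 80 for the truncated moment.
  set N := K * 81 + 1
  have hN : N ≠ ⊤ := by finiteness
  have hN0 : N ≠ 0 := by simp [N]
  refine ⟨min r δ, lt_min hr hδ, ?_⟩
  have hinf : ∀ ξ ∈ Metric.ball (0 : Space 2) (min r δ),
      ⨅ x, ENNReal.ofReal (q' x ξ).re ≤ N * ⨅ x, ENNReal.ofReal (Q.symbol x ξ).re := by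
    intro ξ hξ
    rw [mem_ball_zero_iff] at hξ
    rw [ENNReal.mul_iInf_of_ne hN0 hN]
    refine le_iInf fun x => (iInf_le _ x).trans ((hle x ξ).trans ?_)
    set s := ENNReal.ofReal (Q.symbol x ξ).re
    calc K * (ENNReal.ofReal (‖ξ‖ ^ 2) + Q.truncMoment x ξ) ≤ K * (s + 80 * s) := by
          gcongr
          · exact hδle ξ (hξ.trans_le (min_le_right _ _)) x
          · exact Q.truncMoment_le_symbol hq x ξ
      _ = K * 81 * s := by ring
      _ ≤ N * s := by gcongr; exact le_self_add
  refine (setLIntegral_inv_le_mul measurableSet_ball hN0 hN hinf).trans_lt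
    (ENNReal.mul_lt_top hN.lt_top (lt_of_le_of_lt ?_ hfin))
  exact lintegral_mono_set (Metric.ball_subset_ball (min_le_left _ _))

end LevyQuadruple

end LevyType

theorem theorem5p1 {Ω Ω' : Type*} [mΩ : MeasurableSpace Ω] [mΩ' : MeasurableSpace Ω']
    (P : Kernel (LevyType.Space 2) Ω) (ℱ : Filtration ℝ≥0 mΩ) (F : ℝ≥0 → Ω → LevyType.Space 2)
    (P' : Kernel (LevyType.Space 2) Ω') (ℱ' : Filtration ℝ≥0 mΩ') (F' : ℝ≥0 → Ω' → LevyType.Space 2)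
    (Q Q' : LevyType.LevyQuadruple 2)
    (hF : LevyType.IsLevyTypeProcess P ℱ F Q) (hF' : LevyType.IsLevyTypeProcess P' ℱ' F' Q')
    (hq : LevyType.IsRadialSymbol Q.symbol) (hq' : LevyType.IsRadialSymbol Q'.symbol)
    (hunimodal : ∃ u₀ : ℝ, ∀ x, LevyType.IsQuasiUnimodal (LevyType.firstMarginal (Q.ν x)) u₀)
    (htail : ∃ u₀ : ℝ, 0 ≤ u₀ ∧
      ((∀ x, ∀ u, u₀ ≤ u →
          Q'.ν x (Metric.ball (0 : LevyType.Space 2) u)ᶜ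
            ≤ Q.ν x (Metric.ball (0 : LevyType.Space 2) u)ᶜ) ∨
        (∀ x, ∀ u, u₀ ≤ u →
          Q'.ν x {y : LevyType.Space 2 | u < y 0} ≤ Q.ν x {y : LevyType.Space 2 | u < y 0}))) :
    ((∀ r : ℝ, 0 < r → LevyType.integralInvSup Q.symbol r = ⊤) →
      ∀ r : ℝ, 0 < r → LevyType.integralInvSup Q'.symbol r = ⊤) ∧
    (LevyType.InfiniteLowerSecondMoment Q.ν →
      (∃ r : ℝ, 0 < r ∧ LevyType.integralInvInf Q'.symbol r < ⊤) →
        ∃ r : ℝ, 0 < r ∧ LevyType.integralInvInf Q.symbol r < ⊤) := by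
  obtain ⟨c, -, hc⟩ := hF'.symbol_growth
  obtain ⟨u₀, hu₀, htail⟩ := htail
  obtain ⟨K, hK, hle⟩ := Q.exists_symbol_re_le Q' hq' hF'.symbol_zero hc hu₀ htail
  exact ⟨fun htop r hr => Q.integralInvSup_eq_top hq hK hle htop hr,
    fun hmom ⟨r, hr, hfin⟩ => Q.exists_integralInvInf_lt_top hq hK hle hmom hr hfin⟩
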